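/- Let $\mathbf{k}$ be a local field, i.e. $\mathbb{R}$, $\mathbb{C}$, a finite extension of $\mathbb{Q}_p$, or the field $\mathbb{F}_q((t))$ of formal Laurent series over a finite field $\mathbb{F}_q$. Let $|\cdot|$ be the usual absolute value if $\mathbf{k}=\mathbb{R}$ or $\mathbb{C}$; if $\mathbf{k}$ is nonarchimedean, let $\mathcal{O}$ be its ring of integers and $\omega$ its additive valuation sending uniformizers to $1$. Let $n\geq 2$ and let $$V^+=\{(x_1,\ldots,x_n)\in\mathbb{R}^n,\ x_1+\cdots+x_n=0,\ x_1\geq\cdots\geq x_n\}.$$ Let $K=\mathrm{SO}(n)$, $\mathrm{SU}(n)$ or $\mathrm{SL}_n(\mathcal{O})$ according to whether $\mathbf{k}$ is $\mathbb{R}$, $\mathbb{C}$ or nonarchimedean. Let $A^+\subset\mathrm{SL}_n(\mathbf{k})$ be the set of diagonal matrices $\mathrm{diag}(a_1,\ldots,a_n)$ of determinant one such that $a_i\in\,]0,+\infty[$ for all $i$ and $a_1\geq\cdots\geq a_n$ if $\mathbf{k}=\mathbb{R}$ or $\mathbb{C}$, and such that $\omega(a_1)\leq\cdots\leq\omega(a_n)$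 if $\mathbf{k}$ is nonarchimedean. Let $\mu:\mathrm{SL}_n(\mathbf{k})\to V^+$ be the Cartan projection relative to the Cartan decomposition $\mathrm{SL}_n(\mathbf{k})=KA^+K$: for $g=k_1\,\mathrm{diag}(a_1,\ldots,a_n)\,k_2$ with $k_1,k_2\in K$ and $\mathrm{diag}(a_1,\ldots,a_n)\in A^+$, one has $\mu(g)=(\log|a_1|,\ldots,\log|a_n|)$ if $\mathbf{k}=\mathbb{R}$ or $\mathbb{C}$, and $\mu(g)=(-\omega(a_1),\ldots,-\omega(a_n))$ if $\mathbf{k}$ is nonarchimedean. For $1\leq i\leq n-1$ let $$C_i=\{(x_1,\ldots,x_n)\in V^+,\ x_i>0>x_{i+1}\}.$$ Embed $\mathrm{SL}_{n-1}(\mathbf{k})$ in the upper left corner of $\mathrm{SL}_n(\mathbf{k})$. Let $\Gamma$ be a discrete subgroup of $\mathrm{SL}_n(\mathbf{k})$ that acts properly discontinuously (by left translation) on $\mathrm{SL}_n(\mathbf{k})/\mathrm{SL}_{n-1}(\mathbf{k})$ and that is not a torsion group. Then there exists an integer $1\leq i\leq n-1$ such that $\mu(\gamma)\in C_i\cup C_{n-i}$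 for all $\gamma\in\Gamma$ with at most finitely many exceptions. If moreover $\Gamma$ is not virtually cyclic (i.e. has no cyclic subgroup of finite index), then $C_i=C_{n-i}$. -/

import Mathlib

open scoped MatrixGroups ValuativeRel

universe u

/-- A local field: either `ℝ` or `ℂ` (Mathlib's `RCLike`), or a nonarchimedean local field
(a non-discrete locally compact topological field whose topology comes from a valuation,
that is, a finite extension of `ℚ_p` or a field `𝔽_q((t))`). -/
inductive LocalField : Type (u + 1)
  | arch (k : Type u) [RCLike k] : LocalField
  | nonarch (k : Type u) [Field k] [ValuativeRel k] [TopologicalSpace k]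
      [IsNonarchimedeanLocalField k] : LocalField

namespace LocalField

/-- The underlying type of a local field. -/
@[reducible] def carrier : LocalField.{u} → Type u
  | arch k => k
  | nonarch k => k

instance : CoeSort LocalField.{u} (Type u) := ⟨carrier⟩

noncomputable instance instFieldCarrier : (k : LocalField.{u}) → Field k
  | arch k => inferInstanceAs (Field k)
  | nonarch k => inferInstanceAs (Field k)

instance instTopologicalSpaceCarrier : (k : LocalField.{u}) → TopologicalSpace k
  | arch k => inferInstanceAs (TopologicalSpace k)
  | nonarch k => inferInstanceAs (TopologicalSpace k)

/-- The logarithm of the absolute value: `log |x|` for the usual absolute value if `k` is `ℝ` or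
`ℂ`, and `-ω(x)` if `k` is nonarchimedean, where `ω` is the additive valuation sending uniformizers
to `1` (so `x` lies in the ring of integers iff `-ω(x) ≤ 0`). Used for `x ≠ 0` only. -/
noncomputable def logAbs : (k : LocalField.{u}) → k → ℝ
  | arch _, x => Real.log ‖x‖
  | nonarch k, x => ((WithZero.log (IsNonarchimedeanLocalField.valueGroupWithZeroIsoInt k
      (ValuativeRel.valuation k x)) : ℤ) : ℝ)

/-- The compact group `K`: `SO(n)` for `ℝ`, `SU(n)` for `ℂ`, and `SL_n(𝒪)` if `k` is
nonarchimedean with ring of integers `𝒪`. -/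
def maxCompact (n : ℕ) : (k : LocalField.{u}) → Set SL(n, k)
  | arch k => {g : SL(n, k) | (g : Matrix (Fin n) (Fin n) k) ∈ Matrix.unitaryGroup (Fin n) k}
  | nonarch k => Set.range (Matrix.SpecialLinearGroup.map (n := Fin n) (algebraMap 𝒪[k] k))

/-- The closed positive Weyl chamber `A⁺` of diagonal matrices `diag(a₁, …, aₙ)` of determinant
one: the `aᵢ` are positive real numbers with `a₁ ≥ … ≥ aₙ` if `k` is `ℝ` or `ℂ`, and
`|a₁| ≥ … ≥ |aₙ|` if `k` is nonarchimedean. -/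
def weylChamber (n : ℕ) : (k : LocalField.{u}) → Set SL(n, k)
  | arch k => {g : SL(n, k) | ∃ a : Fin n → ℝ, (∀ i, 0 < a i) ∧ Antitone a ∧
      (g : Matrix (Fin n) (Fin n) k) = Matrix.diagonal fun i => (a i : k)}
  | nonarch k => {g : SL(n, k) | ∃ a : Fin n → k,
      (Antitone fun i => ValuativeRel.valuation k (a i)) ∧
      (g : Matrix (Fin n) (Fin n) k) = Matrix.diagonal a}

/-- `x` is a value at `g` of the Cartan projection: `g = k₁ a k₂` with `k₁, k₂ ∈ K`, `a ∈ A⁺`, and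
`x = (log |a₁|, …, log |aₙ|)`. -/
def IsCartanValue {n : ℕ} (k : LocalField.{u}) (g : SL(n, k)) (x : Fin n → ℝ) : Prop :=
  ∃ k₁ ∈ k.maxCompact n, ∃ a ∈ k.weylChamber n, ∃ k₂ ∈ k.maxCompact n,
    g = k₁ * a * k₂ ∧ x = fun i => k.logAbs (a i i)

open Classical in
/-- The Cartan projection `μ` relative to the Cartan decomposition `SL_n(k) = K A⁺ K`.
By that decomposition `x` exists and is unique for every `g`. -/
noncomputable def cartanProj {n : ℕ} (k : LocalField.{u}) (g : SL(n, k)) : Fin n → ℝ :=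
  if h : ∃ x, k.IsCartanValue g x then h.choose else 0

end LocalField

/-- The closed cone `V⁺` of `x ∈ ℝⁿ` with `x₁ + … + xₙ = 0` and `x₁ ≥ … ≥ xₙ`. -/
def Vplus (n : ℕ) : Set (Fin n → ℝ) := {x | ∑ i, x i = 0 ∧ Antitone x}

/-- The set `C_i = {x ∈ V⁺ | x_i > 0 > x_{i+1}}`, with coordinates numbered from `1` to `n`
(so that `x_i` is the value of `x` at the index `i - 1` of `Fin n`). -/
def Ccomp (n i : ℕ) : Set (Fin n → ℝ) :=
  {x | x ∈ Vplus n ∧ ∃ a b : Fin n, (a : ℕ) + 1 = i ∧ (b : ℕ) + 1 = i + 1 ∧ 0 < x a ∧ x b < 0}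

/-- `SL_{n-1}(R)` as a subgroup of `SL_n(R)`, embedded in the upper left corner: the matrices
whose last row and last column are those of the identity matrix. -/
def SLcorner (n : ℕ) (R : Type*) [CommRing R] : Subgroup SL(n, R) where
  carrier := {g | ∀ i j : Fin n, ((i : ℕ) + 1 = n ∨ (j : ℕ) + 1 = n) →
    g i j = (1 : Matrix (Fin n) (Fin n) R) i j}
  one_mem' := fun i j _ => by simp
  mul_mem' := by
    intro g h hg hh i j hij
    rw [Matrix.SpecialLinearGroup.coe_mul, Matrix.mul_apply]
    rcases hij with hi | hj
    · rw [Finset.sum_congr rfl fun l _ => by rw [hg i l (Or.inl hi)], ← Matrix.mul_apply,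
        Matrix.one_mul, hh i j (Or.inl hi)]
    · rw [Finset.sum_congr rfl fun l _ => by rw [hh l j (Or.inr hj)], ← Matrix.mul_apply,
        Matrix.mul_one, hg i j (Or.inr hj)]
  inv_mem' := by
    intro g hg i j hij
    rcases hij with hi | hj
    · have h1 : ((g * g⁻¹ : SL(n, R)) : Matrix (Fin n) (Fin n) R) i j =
          (1 : Matrix (Fin n) (Fin n) R) i j := by rw [mul_inv_cancel]; rfl
      rw [← h1, Matrix.SpecialLinearGroup.coe_mul, Matrix.mul_apply,
        Finset.sum_congr rfl fun l _ => by rw [hg i l (Or.inl hi)], ← Matrix.mul_apply,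
        Matrix.one_mul]
    · have h1 : ((g⁻¹ * g : SL(n, R)) : Matrix (Fin n) (Fin n) R) i j =
          (1 : Matrix (Fin n) (Fin n) R) i j := by rw [inv_mul_cancel]; rfl
      rw [← h1, Matrix.SpecialLinearGroup.coe_mul, Matrix.mul_apply,
        Finset.sum_congr rfl fun l _ => by rw [hg l j (Or.inr hj)], ← Matrix.mul_apply,
        Matrix.mul_one]

/-- A group is virtually cyclic if it has a cyclic subgroup of finite index. -/
def IsVirtuallyCyclic (G : Type*) [Group G] : Prop :=
  ∃ Z : Subgroup G, IsCyclic Z ∧ Z.FiniteIndex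

/-! Colour `γ` by the number of positive coordinates of `μ(γ)`. If no coordinate vanishes, the
colour names the `C_i` that contains `μ(γ)`, so the theorem says that at most two colours, `i` and
`n - i`, occur infinitely often. Three facts give this.

Walls are avoided (`Matrix.finite_setOf_abs_polarValue_le`). If `|μ(γ)_i| ≤ R`, one diagonal entry
in `γ = k₁ a k₂` lies in a compact subset of `kˣ`. Up to factors from compact sets, `γ` is then an
element of `SL_{n-1}`, hence sends some point of a compact subset of `SL_n / SL_{n-1}` into another
compact subset. Proper discontinuity leaves finitely many such `γ`.

The projection is coarsely equivariant. `μ(sγt) - μ(γ)` is bounded for fixed `s`, `t`, and `μ(γ⁻¹)`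
is, up to a bounded error, minus the reversal of `μ(γ)`. Both follow from a min-max inequality,
`Matrix.abs_diagonal_le`. Far from the walls a bounded error changes no sign, so outside finite sets
the colour is invariant under translations and becomes `n - c` under inversion.

The rest concerns ends of groups (`exists_color_of_almost_invariant`). Along an infinite cyclic
subgroup the colour is eventually `t` at one end and `n - t` at the other, and every left coset has
the same two limits. Only finitely many cosets carry a change of colour; if there are infinitely
many cosets, one is monochromatic and `t = n - t`.

All estimates tolerate bounded errors, so the uniqueness of `μ` plays no role; only the existence of
Cartan decompositions is needed. -/

/-! ### Almost invariant colourings and ends of groups. -/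

/-- A colouring of a group that is almost invariant under left and right translations takes, up to
finitely many exceptions, only the two values that it takes near the ends of an infinite cyclic
subgroup. -/
theorem exists_color_of_almost_invariant {G T : Type*} [Group G] (g₀ : G)
    (hg₀ : ¬ IsOfFinOrder g₀) (c : G → T) (ι : T → T)
    (hright : ∀ s, {g | c (g * s) ≠ c g}.Finite) (hleft : ∀ s, {g | c (s * g) ≠ c g}.Finite)
    (hinv : {g | c g⁻¹ ≠ ι (c g)}.Finite) :
    ∃ t, {g | c g ≠ t ∧ c g ≠ ι t}.Finite ∧ (¬ IsVirtuallyCyclic G → ι t = t) := by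
  have hinj : Function.Injective fun m : ℤ => g₀ ^ m := injective_zpow_iff_not_isOfFinOrder.2 hg₀
  -- The powers of `g₀` are distinct, so they leave every finite set in both directions.
  have hpre : ∀ {S : Set G}, S.Finite → ∃ N : ℕ, ∀ m : ℤ, (N : ℤ) ≤ |m| → g₀ ^ m ∉ S := by
    intro S hS
    have h1 : {m : ℤ | g₀ ^ m ∈ S}.Finite := hS.preimage hinj.injOn
    obtain ⟨N, hN⟩ := (h1.image Int.natAbs).bddAbove
    refine ⟨N + 1, fun m hm hmS => ?_⟩
    have := hN ⟨m, hmS, rfl⟩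
    rw [Int.abs_eq_natAbs] at hm
    omega
  obtain ⟨N, hN⟩ := hpre (hright g₀)
  obtain ⟨M, hM⟩ := hpre hinv
  have hpos : ∀ m : ℕ, c (g₀ ^ ((N : ℤ) + m)) = c (g₀ ^ (N : ℤ)) := by
    intro m
    induction m with
    | zero => simp
    | succ m ih =>
      have h := hN ((N : ℤ) + m) (by rw [abs_of_nonneg] <;> omega)
      simp only [ne_eq, Set.mem_ofPred_eq, not_not] at h
      rw [← ih, ← h, ← zpow_add_one]
      push_cast
      ring_nf
  obtain ⟨P, hP⟩ : ∃ P : ℕ, P = max N M := ⟨_, rfl⟩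
  have hpos' : ∀ m : ℤ, (P : ℤ) ≤ m → c (g₀ ^ m) = c (g₀ ^ (N : ℤ)) := by
    intro m hm
    have := hpos (m - N).toNat
    rwa [show (N : ℤ) + ((m - N).toNat : ℤ) = m by omega] at this
  have hneg' : ∀ m : ℤ, m ≤ -(P : ℤ) → c (g₀ ^ m) = ι (c (g₀ ^ (N : ℤ))) := by
    intro m hm
    have h := hM (-m) (by rw [abs_of_nonneg] <;> omega)
    simp only [ne_eq, Set.mem_ofPred_eq, not_not] at h
    rw [← hpos' (-m) (by omega), ← h]
    simp
  -- Left translation by `g` changes finitely many colours, so the coset of `g` has the same limits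
  -- at its two ends as the subgroup itself.
  have hcoset : ∀ g : G, ∃ Q : ℕ, (∀ m : ℤ, (Q : ℤ) ≤ m → c (g * g₀ ^ m) = c (g₀ ^ (N : ℤ))) ∧
      ∀ m : ℤ, m ≤ -(Q : ℤ) → c (g * g₀ ^ m) = ι (c (g₀ ^ (N : ℤ))) := by
    intro g
    obtain ⟨Q, hQ⟩ := hpre (hleft g)
    refine ⟨max P Q, fun m hm => ?_, fun m hm => ?_⟩
    · have h := hQ m (by rw [abs_of_nonneg] <;> omega)
      simp only [ne_eq, Set.mem_ofPred_eq, not_not] at h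
      rw [h, hpos' m (by omega)]
    · have h := hQ m (by rw [abs_of_nonpos] <;> omega)
      simp only [ne_eq, Set.mem_ofPred_eq, not_not] at h
      rw [h, hneg' m (by omega)]
  have hconst : ∀ g : G, (∀ m : ℤ, c (g * g₀ ^ m * g₀) = c (g * g₀ ^ m)) →
      ∀ m : ℤ, c (g * g₀ ^ m) = c g := by
    intro g hg m
    induction m with
    | zero => simp
    | succ m ih => rw [← ih, ← hg m, mul_assoc, zpow_add_one]
    | pred m ih =>
      rw [← ih]
      conv_rhs => rw [show (-(m : ℤ)) = (-(m : ℤ) - 1) + 1 by ring, zpow_add_one, ← mul_assoc, hg]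
  refine ⟨c (g₀ ^ (N : ℤ)), ?_, ?_⟩
  -- An exceptional element cannot lie in a monochromatic coset, whose only colour would be the
  -- limit `t`. Its coset therefore contains one of the finitely many places `d` where the colour
  -- jumps, and each coset has finitely many exceptions because of its limits.
  · refine Set.Finite.subset ((hright g₀).biUnion fun d _ => ?_ :
      (⋃ d ∈ {g | c (g * g₀) ≠ c g}, (fun m : ℤ => d * g₀ ^ m) ''
        {m : ℤ | c (d * g₀ ^ m) ≠ c (g₀ ^ (N : ℤ)) ∧
          c (d * g₀ ^ m) ≠ ι (c (g₀ ^ (N : ℤ)))}).Finite) ?_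
    · obtain ⟨Q, hQ1, hQ2⟩ := hcoset d
      refine ((Set.finite_Icc (-(Q : ℤ)) Q).subset fun m hm => ?_).image _
      constructor
      · by_contra! h
        exact hm.2 (hQ2 m h.le)
      · by_contra! h
        exact hm.1 (hQ1 m h.le)
    · intro g hg
      by_cases h : ∀ m : ℤ, c (g * g₀ ^ m * g₀) = c (g * g₀ ^ m)
      · obtain ⟨Q, hQ1, -⟩ := hcoset g
        exact absurd ((hconst g h Q).symm.trans (hQ1 Q le_rfl)) hg.1
      · push Not at h
        obtain ⟨m, hm⟩ := h
        refine Set.mem_biUnion (x := g * g₀ ^ m) hm ⟨-m, ?_, by simp [mul_assoc]⟩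
        simpa [mul_assoc] using hg
  · intro hcyc
    -- Infinitely many cosets and finitely many jumps: some coset has none, so its two limits agree.
    have hinf : Infinite (G ⧸ Subgroup.zpowers g₀) := by
      by_contra h
      rw [not_infinite_iff_finite] at h
      exact hcyc ⟨Subgroup.zpowers g₀, inferInstance, Subgroup.finiteIndex_of_finite_quotient⟩
    obtain ⟨q, hq⟩ := (Set.Finite.image
      (QuotientGroup.mk : G → G ⧸ Subgroup.zpowers g₀) (hright g₀)).infinite_compl.nonempty
    obtain ⟨g, rfl⟩ := QuotientGroup.mk_surjective q
    have h : ∀ m : ℤ, c (g * g₀ ^ m * g₀) = c (g * g₀ ^ m) := by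
      intro m
      by_contra hm
      refine hq ⟨g * g₀ ^ m, hm, ?_⟩
      exact (QuotientGroup.mk_mul_of_mem g (Subgroup.zpow_mem_zpowers g₀ m))
    obtain ⟨Q, hQ1, hQ2⟩ := hcoset g
    exact ((hQ2 (-Q) le_rfl).symm.trans (hconst g h _)).trans
      ((hconst g h _).symm.trans (hQ1 Q le_rfl))

/-! ### Min-max inequality and permutation matrices. -/

namespace Matrix

variable {K : Type*} [Field K] (v : AbsoluteValue K ℝ) {n : ℕ}

theorem exists_forall_abs_entry_le (M : Matrix (Fin n) (Fin n) K) :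
    ∃ B : ℝ, 0 ≤ B ∧ ∀ i j, v (M i j) ≤ B :=
  ⟨∑ i, ∑ j, v (M i j), Finset.sum_nonneg fun _ _ => Finset.sum_nonneg fun _ _ => v.nonneg _,
    fun i j => (Finset.single_le_sum (f := fun j => v (M i j)) (fun _ _ => v.nonneg _)
      (Finset.mem_univ j)).trans
      (Finset.single_le_sum (f := fun i => ∑ j, v (M i j))
        (fun _ _ => Finset.sum_nonneg fun _ _ => v.nonneg _) (Finset.mem_univ i))⟩

variable {v}

theorem abs_sum_mul_le {x y : Fin n → K} {A B : ℝ} (hx : ∀ i, v (x i) ≤ A) (hy : ∀ i, v (y i) ≤ B) :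
    v (∑ i, x i * y i) ≤ n * (A * B) := by
  calc v (∑ i, x i * y i) ≤ ∑ i, v (x i * y i) := v.sum_le _ _
    _ ≤ ∑ _i : Fin n, A * B := by
      refine Finset.sum_le_sum fun i _ => ?_
      rw [v.map_mul]
      exact mul_le_mul (hx i) (hy i) (v.nonneg _) ((v.nonneg _).trans (hx i))
    _ = n * (A * B) := by simp

theorem abs_mul_entry_le {M N : Matrix (Fin n) (Fin n) K} {A B : ℝ} (hM : ∀ i j, v (M i j) ≤ A)
    (hN : ∀ i j, v (N i j) ≤ B) (i j : Fin n) : v ((M * N) i j) ≤ n * (A * B) :=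
  abs_sum_mul_le (fun l => hM i l) fun l => hN l j

/-- The min-max principle for singular values, in a form that does not depend on the norm. -/
theorem abs_diagonal_le {a a' : Fin n → K} (ha : Antitone fun i => v (a i))
    (ha' : Antitone fun i => v (a' i)) {U W : Matrix (Fin n) (Fin n) K} {A B : ℝ}
    (hU : ∀ i j, v (U i j) ≤ A) (hW : ∀ i j, v (W i j) ≤ B)
    (h : diagonal a' = U * diagonal a * W) (i : Fin n) :
    v (a' i) ≤ n * A * (n * B) * v (a i) := by
  classical
  -- Only `n - 1` linear conditions are imposed: `(W x)_j = 0` for `j < i` and `x_j = 0` for `j >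
  -- i`. A nonzero solution sees only the entries `a_l` with `l ≥ i`, and its largest coordinate has
  -- index `m ≤ i`, where `|a' m| ≥ |a' i|`.
  let f : (Fin n → K) →ₗ[K] ({j // j ≠ i} → K) := LinearMap.pi fun j =>
    if (j : Fin n) < i then LinearMap.proj (j : Fin n) ∘ₗ W.mulVecLin
    else LinearMap.proj (j : Fin n)
  have hker : f.ker ≠ ⊥ := by
    apply LinearMap.ker_ne_bot_of_finrank_lt
    simp only [Module.finrank_fintype_fun_eq_card]
    exact Fintype.card_subtype_lt (x := i) (by simp)
  obtain ⟨x, hx, hx0⟩ := Submodule.exists_mem_ne_zero_of_ne_bot hker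
  have hlow : ∀ j, j < i → (W *ᵥ x) j = 0 := by
    intro j hj
    have := congrFun (LinearMap.mem_ker.1 hx) ⟨j, hj.ne⟩
    simpa [f, hj] using this
  have hhigh : ∀ j, i < j → x j = 0 := by
    intro j hj
    have := congrFun (LinearMap.mem_ker.1 hx) ⟨j, hj.ne'⟩
    simpa [f, hj.le, not_lt.2 hj.le] using this
  have : Nonempty (Fin n) := ⟨i⟩
  obtain ⟨m, hm⟩ := Finite.exists_max fun j => v (x j)
  have hmx : 0 < v (x m) := by
    obtain ⟨j, hj⟩ := Function.ne_iff.1 hx0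
    exact (v.pos hj).trans_le (hm j)
  have hmi : m ≤ i := by
    by_contra! hlt
    simp [hhigh m hlt] at hmx
  have hWx : ∀ l, v ((W *ᵥ x) l) ≤ n * (B * v (x m)) := fun l =>
    abs_sum_mul_le (fun j => hW l j) hm
  have hawx : ∀ l, v ((diagonal a *ᵥ (W *ᵥ x)) l) ≤ v (a i) * (n * (B * v (x m))) := by
    intro l
    rw [mulVec_diagonal, v.map_mul]
    rcases lt_or_ge l i with hl | hl
    · rw [hlow l hl, v.map_zero, mul_zero]
      exact mul_nonneg (v.nonneg _) ((v.nonneg _).trans (hWx l))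
    · exact mul_le_mul (ha hl) (hWx l) (v.nonneg _) (v.nonneg _)
  have key : a' m * x m = ∑ l, U m l * (diagonal a *ᵥ (W *ᵥ x)) l := by
    have := congrFun (congrArg (· *ᵥ x) h) m
    simp only [mulVec_diagonal, ← mulVec_mulVec] at this
    rw [this]
    rfl
  have h1 : v (a' i) * v (x m) ≤ n * (A * (v (a i) * (n * (B * v (x m))))) := by
    calc v (a' i) * v (x m) ≤ v (a' m) * v (x m) :=
          mul_le_mul_of_nonneg_right (ha' hmi) (v.nonneg _)
      _ = v (a' m * x m) := (v.map_mul _ _).symm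
      _ ≤ _ := by
        rw [key]
        exact abs_sum_mul_le (fun l => hU m l) hawx
  refine le_of_mul_le_mul_right (h1.trans_eq ?_) hmx
  ring

theorem mulPerm_entry (M : Matrix (Fin n) (Fin n) K) (σ : Equiv.Perm (Fin n)) (i j : Fin n) :
    (M * σ.permMatrix K) i j = M i (σ.symm j) := by
  rw [Equiv.Perm.permMatrix, PEquiv.mul_toMatrix_toPEquiv]
  rfl

theorem permMul_entry (M : Matrix (Fin n) (Fin n) K) (σ : Equiv.Perm (Fin n)) (i j : Fin n) :
    (σ.permMatrix K * M) i j = M (σ i) j := by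
  rw [Equiv.Perm.permMatrix, PEquiv.toMatrix_toPEquiv_mul]
  rfl

theorem permMatrix_conj_diagonal (σ : Equiv.Perm (Fin n)) (a : Fin n → K) :
    σ.permMatrix K * diagonal a * (σ⁻¹).permMatrix K = diagonal (a ∘ σ) := by
  ext i j
  rw [mulPerm_entry, permMul_entry, show (σ⁻¹).symm = σ from inv_inv σ]
  simp [diagonal_apply]

/-- A permutation matrix may have determinant `-1`; rescaling one column by the sign corrects this
and does not affect how it permutes diagonal entries. It serves to bring a chosen entry to the last
position, the one fixed by `SLcorner`. -/
theorem exists_specialLinear_diagonal_mul (σ : Equiv.Perm (Fin n)) :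
    ∃ W : SL(n, K), ∀ a : Fin n → K,
      diagonal a * (W : Matrix (Fin n) (Fin n) K) = W * diagonal (a ∘ σ.symm) := by
  classical
  rcases Nat.eq_zero_or_pos n with rfl | hn
  · exact ⟨1, fun a => by ext i; exact i.elim0⟩
  let c : Fin n → K := fun j => if j = ⟨0, hn⟩ then ((Equiv.Perm.sign σ : ℤ) : K) else 1
  refine ⟨⟨σ.permMatrix K * diagonal c, ?_⟩, fun a => ?_⟩
  · rw [det_mul, det_permutation, det_diagonal, Finset.prod_ite_eq' Finset.univ,
      if_pos (Finset.mem_univ _), ← Int.cast_mul, ← Units.val_mul, Int.units_mul_self]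
    simp
  · change diagonal a * (σ.permMatrix K * diagonal c) = σ.permMatrix K * diagonal c * _
    ext i j
    rw [mul_diagonal, permMul_entry, diagonal_mul, permMul_entry]
    by_cases h : σ i = j
    · subst h
      simp [mul_comm]
    · simp [diagonal_apply_ne _ h]

end Matrix

/-! ### Polar values and their behaviour under translation and inversion. -/

namespace Matrix

variable {K : Type*} [Field K] {n : ℕ}

/-- `x` is the vector of logarithms of the absolute values of the diagonal entries in a
decomposition `g = k₁ a k₂`, where `a` is diagonal with entries of decreasing absolute value and
the matrices `k₁`, `k₂` and their inverses have entries of absolute value at most one. -/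
def IsPolarValue (v : AbsoluteValue K ℝ) (g : SL(n, K)) (x : Fin n → ℝ) : Prop :=
  ∃ (k₁ k₂ : SL(n, K)) (a : Fin n → K),
    (∀ i j, v (k₁ i j) ≤ 1) ∧ (∀ i j, v (k₁⁻¹ i j) ≤ 1) ∧
    (∀ i j, v (k₂ i j) ≤ 1) ∧ (∀ i j, v (k₂⁻¹ i j) ≤ 1) ∧
    (Antitone fun i => v (a i)) ∧
    (g : Matrix (Fin n) (Fin n) K) = k₁ * diagonal a * k₂ ∧
    x = fun i => Real.log (v (a i))

theorem prod_eq_one_of_polar {g k₁ k₂ : SL(n, K)} {a : Fin n → K}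
    (h : (g : Matrix (Fin n) (Fin n) K) = k₁ * diagonal a * k₂) : ∏ i, a i = 1 := by
  have := congrArg det h
  simpa using this.symm

theorem ne_zero_of_polar {g k₁ k₂ : SL(n, K)} {a : Fin n → K}
    (h : (g : Matrix (Fin n) (Fin n) K) = k₁ * diagonal a * k₂) (i : Fin n) : a i ≠ 0 := by
  intro hi
  have := prod_eq_one_of_polar h
  rw [Finset.prod_eq_zero (Finset.mem_univ i) hi] at this
  exact zero_ne_one this

theorem SpecialLinearGroup.val_mul_inv (g : SL(n, K)) :
    (g : Matrix (Fin n) (Fin n) K) * (g⁻¹ : SL(n, K)) = 1 := by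
  rw [← SpecialLinearGroup.coe_mul, mul_inv_cancel, SpecialLinearGroup.coe_one]

theorem SpecialLinearGroup.val_inv_mul (g : SL(n, K)) :
    ((g⁻¹ : SL(n, K)) : Matrix (Fin n) (Fin n) K) * g = 1 := by
  rw [← SpecialLinearGroup.coe_mul, inv_mul_cancel, SpecialLinearGroup.coe_one]

theorem eq_inv_mul_mul_inv_of_polar {k₁ k₂ : SL(n, K)} {M N : Matrix (Fin n) (Fin n) K}
    (h : M = k₁ * N * k₂) : N = (k₁⁻¹ : SL(n, K)) * M * (k₂⁻¹ : SL(n, K)) := by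
  rw [h]
  simp only [← mul_assoc]
  rw [SpecialLinearGroup.val_inv_mul, one_mul, mul_assoc, SpecialLinearGroup.val_mul_inv, mul_one]

variable {v : AbsoluteValue K ℝ}

theorem IsPolarValue.mem_Vplus {g : SL(n, K)} {x : Fin n → ℝ} (h : IsPolarValue v g x) :
    x ∈ Vplus n := by
  obtain ⟨k₁, k₂, a, -, -, -, -, ha, hg, rfl⟩ := h
  have h0 := ne_zero_of_polar hg
  refine ⟨?_, fun i j hij => Real.log_le_log (v.pos (h0 j)) (ha hij)⟩
  rw [← Real.log_prod fun i _ => (v.pos (h0 i)).ne', ← map_prod, prod_eq_one_of_polar hg]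
  simp

theorem log_abs_diagonal_le {a a' : Fin n → K} (ha : Antitone fun i => v (a i))
    (ha' : Antitone fun i => v (a' i)) (h0 : ∀ i, a i ≠ 0) (h0' : ∀ i, a' i ≠ 0)
    {U W : Matrix (Fin n) (Fin n) K} {A B : ℝ}
    (hU : ∀ i j, v (U i j) ≤ A) (hW : ∀ i j, v (W i j) ≤ B)
    (h : diagonal a' = U * diagonal a * W) (i : Fin n) :
    Real.log (v (a' i)) ≤ Real.log (n * A * (n * B)) + Real.log (v (a i)) := by
  have h1 := abs_diagonal_le ha ha' hU hW h i
  have hpos : 0 < n * A * (n * B) :=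
    pos_of_mul_pos_left ((v.pos (h0' i)).trans_le h1) (v.nonneg _)
  rw [← Real.log_mul hpos.ne' (v.pos (h0 i)).ne']
  exact Real.log_le_log (v.pos (h0' i)) h1

/-- If `g = k₁ a k₂` and `s g t = l₁ b l₂`, then `b = (l₁⁻¹ s k₁) a (k₂ t l₂⁻¹)`. The entries of the
outer factors are bounded in terms of `s` and `t` only, so the min-max inequality applies uniformly
in `g`. -/
theorem IsPolarValue.exists_le_translate (s t : SL(n, K)) :
    ∃ C : ℝ, ∀ g x x', IsPolarValue v g x → IsPolarValue v (s * g * t) x' →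
      ∀ i, x' i ≤ C + x i := by
  obtain ⟨A, -, hA⟩ := exists_forall_abs_entry_le v (s : Matrix (Fin n) (Fin n) K)
  obtain ⟨B, -, hB⟩ := exists_forall_abs_entry_le v (t : Matrix (Fin n) (Fin n) K)
  refine ⟨Real.log (n * (n * (1 * (n * (A * 1)))) * (n * (n * (1 * (n * (B * 1)))))), ?_⟩
  rintro g x x' ⟨k₁, k₂, a, h1, h1', h2, h2', ha, hg, rfl⟩
    ⟨l₁, l₂, b, m1, m1', m2, m2', hb, hg', rfl⟩ i
  refine log_abs_diagonal_le ha hb (ne_zero_of_polar hg) (ne_zero_of_polar hg')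
    (U := (l₁⁻¹ : SL(n, K)) * ((s : Matrix (Fin n) (Fin n) K) * k₁))
    (W := (k₂ : Matrix (Fin n) (Fin n) K) * t * (l₂⁻¹ : SL(n, K)))
    (abs_mul_entry_le m1' (abs_mul_entry_le hA h1)) ?_ ?_ i
  · have := abs_mul_entry_le (abs_mul_entry_le h2 hB) m2'
    intro i j
    refine (this i j).trans_eq ?_
    ring
  · rw [eq_inv_mul_mul_inv_of_polar hg']
    simp only [SpecialLinearGroup.coe_mul, hg, mul_assoc]

theorem IsPolarValue.exists_abs_sub_le (s t : SL(n, K)) :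
    ∃ C : ℝ, ∀ g x x', IsPolarValue v g x → IsPolarValue v (s * g * t) x' →
      ∀ i, |x' i - x i| ≤ C := by
  obtain ⟨C, hC⟩ := IsPolarValue.exists_le_translate (v := v) s t
  obtain ⟨D, hD⟩ := IsPolarValue.exists_le_translate (v := v) s⁻¹ t⁻¹
  refine ⟨max C D, fun g x x' hx hx' i => ?_⟩
  have h1 := hC g x x' hx hx' i
  have h2 := hD (s * g * t) x' x hx' (by simpa [mul_assoc] using hx) i
  rw [abs_le]
  constructor <;> linarith [le_max_left C D, le_max_right C D]

theorem inv_eq_of_polar {g k₁ k₂ : SL(n, K)} {a : Fin n → K}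
    (hg : (g : Matrix (Fin n) (Fin n) K) = k₁ * diagonal a * k₂) :
    ((g⁻¹ : SL(n, K)) : Matrix (Fin n) (Fin n) K) =
      (k₂⁻¹ : SL(n, K)) * diagonal (fun i => (a i)⁻¹) * (k₁⁻¹ : SL(n, K)) := by
  have e : (g : Matrix (Fin n) (Fin n) K) * ((k₂⁻¹ : SL(n, K)) * diagonal (fun i => (a i)⁻¹) *
      (k₁⁻¹ : SL(n, K))) = 1 := by
    rw [hg]
    calc _ = (k₁ : Matrix (Fin n) (Fin n) K) * (diagonal a * ((k₂ : Matrix (Fin n) (Fin n) K) *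
          (k₂⁻¹ : SL(n, K))) * diagonal (fun i => (a i)⁻¹)) * (k₁⁻¹ : SL(n, K)) := by
          simp only [mul_assoc]
      _ = 1 := by
        rw [SpecialLinearGroup.val_mul_inv, mul_one, diagonal_mul_diagonal]
        simp only [mul_inv_cancel₀ (ne_zero_of_polar hg _), diagonal_one, mul_one,
          SpecialLinearGroup.val_mul_inv]
  calc _ = ((g⁻¹ : SL(n, K)) : Matrix (Fin n) (Fin n) K) * (g * _) := by rw [e, mul_one]
    _ = _ := by rw [← mul_assoc, SpecialLinearGroup.val_inv_mul, one_mul]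

theorem revPerm_conj_diagonal (c : Fin n → K) :
    (Fin.revPerm (n := n)).permMatrix K * diagonal c * (Fin.revPerm (n := n)).permMatrix K =
      diagonal (c ∘ Fin.rev) :=
  permMatrix_conj_diagonal (Fin.revPerm (n := n)) c

/-- The diagonal part of `g⁻¹ = k₂⁻¹ a⁻¹ k₁⁻¹` is sorted the wrong way. The order-reversing
permutation repairs this without enlarging entry bounds, and the min-max inequality compares the
result with any other polar form of `g⁻¹` in both directions. -/
theorem IsPolarValue.exists_abs_inv_add_le :
    ∃ C : ℝ, ∀ (g : SL(n, K)) x x', IsPolarValue v g x → IsPolarValue v g⁻¹ x' →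
      ∀ i, |x' i + x i.rev| ≤ C := by
  refine ⟨Real.log (n * (n * (1 * 1)) * (n * (n * (1 * 1)))), ?_⟩
  rintro g x x' ⟨k₁, k₂, a, h1, h1', h2, h2', ha, hg, rfl⟩
    ⟨l₁, l₂, b, m1, m1', m2, m2', hb, hg', rfl⟩ i
  have h0 := ne_zero_of_polar hg
  have hinv := inv_eq_of_polar hg
  let P := (Fin.revPerm (n := n)).permMatrix K
  have ha' : Antitone fun i : Fin n => v (a i.rev)⁻¹ := by
    intro i j hij
    simp only [map_inv₀]
    exact inv_anti₀ (v.pos (h0 _)) (ha (Fin.rev_le_rev.2 hij))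
  have hP : P * diagonal (fun i => (a i.rev)⁻¹) * P = diagonal fun i => (a i)⁻¹ := by
    rw [revPerm_conj_diagonal]
    congr 1
    ext; simp
  have upper := log_abs_diagonal_le (v := v) (a := fun i => (a i.rev)⁻¹) (a' := b)
    (U := (l₁⁻¹ : SL(n, K)) * (k₂⁻¹ : SL(n, K)) * P)
    (W := P * ((k₁⁻¹ : SL(n, K)) * (l₂⁻¹ : SL(n, K)))) (A := n * (1 * 1)) (B := n * (1 * 1))
    ha' hb (fun i => inv_ne_zero (h0 _)) (ne_zero_of_polar hg')
    (fun i j => by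
      rw [mulPerm_entry]
      exact abs_mul_entry_le m1' h2' _ _)
    (fun i j => by
      rw [permMul_entry]
      exact abs_mul_entry_le h1' m2' _ _)
    (by
      rw [eq_inv_mul_mul_inv_of_polar hg', hinv, ← hP]
      simp only [mul_assoc]) i
  have lower := log_abs_diagonal_le (v := v) (a := b) (a' := fun i => (a i.rev)⁻¹)
    (U := P * (k₂ * l₁)) (W := l₂ * k₁ * P) (A := n * (1 * 1)) (B := n * (1 * 1))
    hb ha' (ne_zero_of_polar hg') (fun i => inv_ne_zero (h0 _))
    (fun i j => by
      rw [permMul_entry]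
      exact abs_mul_entry_le h2 m1 _ _)
    (fun i j => by
      rw [mulPerm_entry]
      exact abs_mul_entry_le m2 h1 _ _)
    (by
      have e := eq_inv_mul_mul_inv_of_polar hinv
      rw [inv_inv, inv_inv, hg'] at e
      have e' := revPerm_conj_diagonal fun i => (a i)⁻¹
      rw [e] at e'
      refine Eq.trans e'.symm ?_
      simp only [mul_assoc, P]) i
  simp only [map_inv₀, Real.log_inv] at upper lower
  rw [abs_le]
  constructor <;> linarith

/-! ### Proper discontinuity keeps the projection away from the walls. -/

theorem isCompact_setOf_entry_mem [TopologicalSpace K] [IsTopologicalRing K] [T1Space K]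
    {B : Set K} (hB : IsCompact B) : IsCompact {g : SL(n, K) | ∀ i j, g i j ∈ B} := by
  have h : IsCompact {M : Matrix (Fin n) (Fin n) K | ∀ i, M i ∈ {r : Fin n → K | ∀ j, r j ∈ B}} :=
    isCompact_pi_infinite fun _ => isCompact_pi_infinite fun _ => hB
  exact SpecialLinearGroup.isClosedEmbedding_val.isCompact_preimage h

/-- In a group acting properly discontinuously on `SL_n / SL_{n-1}`, the Cartan projection leaves
every neighbourhood of bounded radius of the walls `x_i = 0`. -/
theorem finite_setOf_abs_polarValue_le [TopologicalSpace K] [IsTopologicalRing K] [T1Space K]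
    (hv : ∀ R : ℝ, ∃ B : Set K, IsCompact B ∧ {y | v y ≤ R} ⊆ B) (hn : 2 ≤ n)
    (Γ : Subgroup SL(n, K)) (hproper : ProperlyDiscontinuousSMul Γ (SL(n, K) ⧸ SLcorner n K))
    (μ : SL(n, K) → Fin n → ℝ) (hμ : ∀ g, IsPolarValue v g (μ g)) (R : ℝ) :
    {γ : Γ | ∃ i, |μ γ i| ≤ R}.Finite := by
  classical
  suffices h : ∀ i, {γ : Γ | |μ γ i| ≤ R}.Finite by
    refine (Set.finite_iUnion h).subset fun γ hγ => ?_
    obtain ⟨i, hi⟩ := hγ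
    exact Set.mem_iUnion.2 ⟨i, hi⟩
  intro i
  let first : Fin n := ⟨0, by omega⟩
  let last : Fin n := ⟨n - 1, by omega⟩
  have hfl : first ≠ last := by
    intro h
    have := congrArg Fin.val h
    simp only [first, last] at this
    omega
  obtain ⟨W, hW⟩ := exists_specialLinear_diagonal_mul (K := K) (Equiv.swap i last)
  obtain ⟨B₁, hB₁, hB₁'⟩ := hv 1
  -- This bound covers all entries of the matrix `t` below: `0`, `1`, and `(a i)^{±1}`, of absolute
  -- value at most `exp R`.
  obtain ⟨B₂, hB₂, hB₂'⟩ := hv (max 1 (Real.exp R))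
  have hX₁ := isCompact_setOf_entry_mem (n := n) hB₁
  have hX₂ := isCompact_setOf_entry_mem (n := n) hB₂
  set X₁ := {g : SL(n, K) | ∀ i j, g i j ∈ B₁}
  set X₂ := {g : SL(n, K) | ∀ i j, g i j ∈ B₂}
  have hπ : Continuous (QuotientGroup.mk : SL(n, K) → SL(n, K) ⧸ SLcorner n K) :=
    continuous_quotient_mk'
  have hS : IsCompact ((fun p : SL(n, K) × SL(n, K) =>
      (QuotientGroup.mk (p.1 * W * p.2) : SL(n, K) ⧸ SLcorner n K)) '' (X₁ ×ˢ X₂)) :=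
    (hX₁.prod hX₂).image (hπ.comp (by fun_prop))
  have hT : IsCompact ((fun p : SL(n, K) =>
      (QuotientGroup.mk (p * W) : SL(n, K) ⧸ SLcorner n K)) '' X₁) :=
    hX₁.image (hπ.comp (by fun_prop))
  refine (hproper.finite_disjoint_inter_image hS hT).subset fun γ hγ => ?_
  obtain ⟨k₁, k₂, a, h1, -, -, h2, -, hg, hx⟩ := hμ γ
  have h0 := ne_zero_of_polar hg
  have hR : |Real.log (v (a i))| ≤ R := by
    have : |μ γ i| ≤ R := hγ
    rwa [hx] at this
  rw [abs_le] at hR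
  -- The entry `(a i)⁻¹` in last position cancels `a i` once `W` has moved it there; `a i` in first
  -- position restores determinant one.
  let d : Fin n → K := fun j => if j = first then a i else if j = last then (a i)⁻¹ else 1
  let t : SL(n, K) := ⟨diagonal d, by
    rw [det_diagonal, ← Finset.mul_prod_erase _ _ (Finset.mem_univ first),
      ← Finset.mul_prod_erase _ _ (Finset.mem_erase.2 ⟨hfl.symm, Finset.mem_univ last⟩),
      Finset.prod_eq_one]
    · simp [d, hfl.symm, h0 i]
    · intro j hj
      simp only [Finset.mem_erase] at hj
      simp [d, hj.1, hj.2.1]⟩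
  have hγ' : W⁻¹ * k₁⁻¹ * (γ : SL(n, K)) * k₂⁻¹ * W * t ∈ SLcorner n K := by
    have e : ((W⁻¹ * k₁⁻¹ * (γ : SL(n, K)) * k₂⁻¹ * W * t : SL(n, K)) : Matrix (Fin n) (Fin n) K) =
        diagonal fun j => a (Equiv.swap i last j) * d j := by
      have e1 : ((k₁⁻¹ * (γ : SL(n, K)) * k₂⁻¹ : SL(n, K)) : Matrix (Fin n) (Fin n) K) = diagonal a := by
        rw [eq_inv_mul_mul_inv_of_polar hg]
        simp only [SpecialLinearGroup.coe_mul]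
      rw [show W⁻¹ * k₁⁻¹ * (γ : SL(n, K)) * k₂⁻¹ * W * t = W⁻¹ * (k₁⁻¹ * (γ : SL(n, K)) * k₂⁻¹ * W) * t by
        simp only [mul_assoc], SpecialLinearGroup.coe_mul, SpecialLinearGroup.coe_mul,
        SpecialLinearGroup.coe_mul (k₁⁻¹ * (γ : SL(n, K)) * k₂⁻¹), e1, hW, ← mul_assoc,
        SpecialLinearGroup.val_inv_mul, one_mul]
      exact diagonal_mul_diagonal _ _
    intro p q hpq
    rw [e]
    by_cases h : p = q
    · subst h
      have hp : p = last := by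
        ext
        simp only [last]
        omega
      subst hp
      simp [d, hfl.symm, h0 i]
    · rw [diagonal_apply_ne _ h, one_apply_ne h]
  have ht : t ∈ X₂ := by
    intro p q
    refine hB₂' ?_
    change v (diagonal d p q) ≤ _
    by_cases h : p = q
    · subst h
      rw [diagonal_apply_eq]
      simp only [d]
      split_ifs
      · refine le_max_of_le_right ?_
        rw [← Real.log_le_iff_le_exp (v.pos (h0 i))]
        exact hR.2
      · refine le_max_of_le_right ?_
        rw [← Real.log_le_iff_le_exp (v.pos (inv_ne_zero (h0 i))), map_inv₀, Real.log_inv]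
        linarith
      · simp
    · rw [diagonal_apply_ne _ h, v.map_zero]
      exact zero_le_one.trans (le_max_left _ _)
  -- The element `γ` sends the class of `k₂⁻¹ W t` to the class of `k₁ W`, and both lie in compact
  -- sets that do not depend on `γ`.
  refine ⟨QuotientGroup.mk (k₁ * W), ⟨QuotientGroup.mk (k₂⁻¹ * W * t),
    ⟨(k₂⁻¹, t), ⟨fun p q => hB₁' (h2 p q), ht⟩, rfl⟩, ?_⟩, ⟨k₁, fun p q => hB₁' (h1 p q), rfl⟩⟩
  change (QuotientGroup.mk ((γ : SL(n, K)) * (k₂⁻¹ * W * t)) : SL(n, K) ⧸ SLcorner n K) = _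
  refine (QuotientGroup.eq.2 ?_).symm
  simpa [mul_assoc] using hγ'

end Matrix

/-! ### The colouring by number of positive coordinates. -/

/-- The number of positive coordinates. -/
noncomputable def posCount {n : ℕ} (x : Fin n → ℝ) : ℕ := by
  classical exact (Finset.univ.filter fun i => 0 < x i).card

theorem posCount_congr {n : ℕ} {x y : Fin n → ℝ} (h : ∀ i, 0 < x i ↔ 0 < y i) :
    posCount x = posCount y := by
  classical
  simp only [posCount]
  congr 1
  ext i
  simp [h]

theorem posCount_rev_neg {n : ℕ} {x y : Fin n → ℝ} (h : ∀ i, 0 < y i ↔ ¬ 0 < x i.rev) :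
    posCount y = n - posCount x := by
  classical
  have e : (Finset.univ.filter fun i => 0 < y i).card =
      (Finset.univ.filter fun i => ¬ 0 < x i).card := by
    refine Finset.card_bij (fun i _ => i.rev) ?_ ?_ ?_
    · intro i hi
      simpa [h] using hi
    · intro i _ j _ hij
      exact Fin.rev_injective hij
    · intro i hi
      exact ⟨i.rev, by simpa [h] using hi, by simp⟩
  have := Finset.card_filter_add_card_filter_not (s := (Finset.univ : Finset (Fin n)))
    (fun i => 0 < x i)
  rw [Finset.card_univ, Fintype.card_fin] at this
  simp only [posCount]
  omega

theorem lt_posCount_iff {n : ℕ} {x : Fin n → ℝ} (hx : Antitone x) (i : Fin n) :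
    (i : ℕ) < posCount x ↔ 0 < x i := by
  classical
  simp only [posCount]
  constructor
  · intro h
    by_contra hi
    have hsub : (Finset.univ.filter fun j => 0 < x j) ⊆ Finset.Iio i := by
      intro j hj
      simp only [Finset.mem_filter, Finset.mem_univ, true_and, Finset.mem_Iio] at hj ⊢
      by_contra! hij
      exact hi (hj.trans_le (hx hij))
    have := Finset.card_le_card hsub
    rw [Fin.card_Iio] at this
    omega
  · intro h
    have hsub : Finset.Iic i ⊆ (Finset.univ.filter fun j => 0 < x j) := by
      intro j hj
      simp only [Finset.mem_filter, Finset.mem_univ, true_and, Finset.mem_Iic] at hj ⊢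
      exact h.trans_le (hx hj)
    have := Finset.card_le_card hsub
    rw [Fin.card_Iic] at this
    omega

/-- Nonzero coordinates with sum zero take both signs, which excludes the counts `0` and `n`. -/
theorem mem_Ccomp_posCount {n : ℕ} (hn : 2 ≤ n) {x : Fin n → ℝ} (hx : x ∈ Vplus n)
    (h0 : ∀ i, x i ≠ 0) :
    1 ≤ posCount x ∧ posCount x ≤ n - 1 ∧ x ∈ Ccomp n (posCount x) := by
  have hne : (Finset.univ : Finset (Fin n)).Nonempty := ⟨⟨0, by omega⟩, Finset.mem_univ _⟩
  have h1 : 1 ≤ posCount x := by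
    by_contra! h
    refine (Finset.sum_neg (fun i _ => ?_) hne).ne hx.1
    have := (lt_posCount_iff hx.2 i).not
    have hi : ¬ 0 < x i := this.1 (by omega)
    exact lt_of_le_of_ne (not_lt.1 hi) (h0 i)
  have h2 : posCount x ≤ n - 1 := by
    by_contra! h
    refine (Finset.sum_pos (fun i _ => ?_) hne).ne' hx.1
    exact (lt_posCount_iff hx.2 i).1 (by omega)
  refine ⟨h1, h2, hx, ⟨posCount x - 1, by omega⟩, ⟨posCount x, by omega⟩, ?_, rfl, ?_, ?_⟩
  · simp only
    omega
  · exact (lt_posCount_iff hx.2 _).1 (by simp only; omega)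
  · refine lt_of_le_of_ne (not_lt.1 fun h => ?_) (h0 _)
    exact lt_irrefl _ ((lt_posCount_iff hx.2 _).2 h)

theorem exists_Ccomp_of_polarValue {K : Type*} [Field K] [TopologicalSpace K] [IsTopologicalRing K]
    [T1Space K] {v : AbsoluteValue K ℝ}
    (hv : ∀ R : ℝ, ∃ B : Set K, IsCompact B ∧ {y | v y ≤ R} ⊆ B) {n : ℕ} (hn : 2 ≤ n)
    (Γ : Subgroup SL(n, K)) (hproper : ProperlyDiscontinuousSMul Γ (SL(n, K) ⧸ SLcorner n K))
    (htorsion : ¬ IsMulTorsion Γ)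
    (μ : SL(n, K) → Fin n → ℝ) (hμ : ∀ g, Matrix.IsPolarValue v g (μ g)) :
    ∃ i : ℕ, 1 ≤ i ∧ i ≤ n - 1 ∧
      {γ : Γ | μ (γ : SL(n, K)) ∉ Ccomp n i ∪ Ccomp n (n - i)}.Finite ∧
      (¬ IsVirtuallyCyclic Γ → Ccomp n i = Ccomp n (n - i)) := by
  have hfin := Matrix.finite_setOf_abs_polarValue_le hv hn Γ hproper μ hμ
  obtain ⟨γ₀, hγ₀⟩ := (not_isMulTorsion_iff _).1 htorsion
  -- Outside a finite set every coordinate exceeds the translation error `C` in absolute value, so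
  -- no sign changes.
  have htrans : ∀ s t : Γ, {g : Γ | posCount (μ (s * g * t : Γ)) ≠ posCount (μ g)}.Finite := by
    intro s t
    obtain ⟨C, hC⟩ := Matrix.IsPolarValue.exists_abs_sub_le (v := v) (s : SL(n, K)) (t : SL(n, K))
    refine (hfin C).subset fun g hg => ?_
    by_contra h
    refine hg (posCount_congr fun i => ?_)
    have h1 := hC g _ _ (hμ g) (hμ (s * g * t : Γ)) i
    have h2 : C < |μ g i| := not_le.1 fun hle => h ⟨i, hle⟩
    rw [abs_le] at h1
    rcases abs_cases (μ g i) with ⟨h3, h4⟩ | ⟨h3, h4⟩ <;> constructor <;> intro h5 <;> linarith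
  obtain ⟨i, hi, hcyc⟩ := exists_color_of_almost_invariant γ₀ hγ₀ (fun g : Γ => posCount (μ g))
    (fun m => n - m) (fun s => by simpa using htrans 1 s) (fun s => by simpa using htrans s 1) (by
      obtain ⟨C, hC⟩ := Matrix.IsPolarValue.exists_abs_inv_add_le (v := v) (n := n)
      refine (hfin C).subset fun g hg => ?_
      by_contra h
      refine hg (posCount_rev_neg fun i => ?_)
      have h1 := hC g _ _ (hμ g) (hμ (g⁻¹ : Γ)) i
      have h2 : C < |μ g i.rev| := not_le.1 fun hle => h ⟨_, hle⟩
      rw [abs_le] at h1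
      rcases abs_cases (μ g i.rev) with ⟨h3, h4⟩ | ⟨h3, h4⟩ <;> constructor <;> intro h5 <;>
        linarith)
  have hgood : ∀ g : Γ, g ∉ {γ : Γ | ∃ i, |μ γ i| ≤ 0} → 1 ≤ posCount (μ g) ∧
      posCount (μ g) ≤ n - 1 ∧ μ g ∈ Ccomp n (posCount (μ g)) := fun g hg =>
    mem_Ccomp_posCount hn (hμ g).mem_Vplus fun j hj => hg ⟨j, by simp [hj]⟩
  -- An element outside both exceptional sets has colour `i` or `n - i` and a colour between `1` and
  -- `n - 1`; this puts `i` in the required range.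
  have : Infinite Γ := Infinite.of_injective (fun m : ℤ => γ₀ ^ m)
    (injective_zpow_iff_not_isOfFinOrder.2 hγ₀)
  obtain ⟨g, hg⟩ := (hi.union (hfin 0)).infinite_compl.nonempty
  rw [Set.mem_compl_iff, Set.mem_union, not_or] at hg
  have hg1 := hgood g hg.2
  have hrange : 1 ≤ i ∧ i ≤ n - 1 := by
    by_cases h : posCount (μ g) = i
    · omega
    · have : posCount (μ g) = n - i := by
        by_contra h'
        exact hg.1 ⟨h, h'⟩
      omega
  refine ⟨i, hrange.1, hrange.2, (hi.union (hfin 0)).subset fun γ hγ => ?_,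
    fun h => by rw [hcyc h]⟩
  by_contra hγ'
  rw [Set.mem_union, not_or] at hγ'
  have hγ1 := (hgood γ hγ'.2).2.2
  refine hγ'.1 ⟨fun h => hγ (Or.inl (h ▸ hγ1)), fun h => hγ (Or.inr (h ▸ hγ1))⟩

/-! ### Smith normal form and sorting of diagonal factors. -/

namespace Matrix

/-- **Smith normal form** of a nonsingular square matrix over a principal ideal domain. -/
theorem exists_smith_normal_form {R : Type*} [CommRing R] [IsDomain R] [IsPrincipalIdealRing R]
    {n : ℕ} (G : Matrix (Fin n) (Fin n) R) (hG : G.det ≠ 0) :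
    ∃ (B Q : Matrix (Fin n) (Fin n) R) (d : Fin n → R),
      IsUnit B.det ∧ IsUnit Q.det ∧ G = B * diagonal d * Q := by
  -- The columns span a submodule of full rank. Take a basis `b` of `R^n` and a basis `e` of that
  -- submodule with `e i = a i • b i`; the two outer factors are the changes of basis.
  have hli : LinearIndependent R G.col := linearIndependent_cols_of_det_ne_zero hG
  let c := Module.Basis.span hli
  obtain ⟨b, a, e, h⟩ := Submodule.exists_smith_normal_form_of_rank_eq (Pi.basisFun R (Fin n))
    (N := Submodule.span R (Set.range G.col)) (by
      rw [Module.finrank_eq_card_basis c, Module.finrank_eq_card_basis (Pi.basisFun R (Fin n))])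
  refine ⟨(Pi.basisFun R (Fin n)).toMatrix b, e.toMatrix c, a, ?_, ?_, ?_⟩
  · have := congrArg det ((Pi.basisFun R (Fin n)).toMatrix_mul_toMatrix_flip b)
    rw [det_mul, det_one] at this
    exact IsUnit.of_mul_eq_one _ this
  · have := congrArg det (e.toMatrix_mul_toMatrix_flip c)
    rw [det_mul, det_one] at this
    exact IsUnit.of_mul_eq_one _ this
  · ext i j
    have h1 : (c j : Fin n → R) i = G i j := by
      rw [Module.Basis.span_apply]
      rfl
    have h2 := congrArg (fun x : Submodule.span R (Set.range G.col) => (x : Fin n → R) i)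
      (e.sum_toMatrix_smul_self c (j := j))
    simp only [AddSubmonoidClass.coe_finsetSum, SetLike.val_smul, h, Finset.sum_apply,
      Pi.smul_apply, smul_eq_mul] at h2
    rw [← h1, ← h2, mul_apply]
    refine Finset.sum_congr rfl fun l _ => ?_
    rw [mul_diagonal]
    simp only [Module.Basis.toMatrix_apply, Pi.basisFun_repr]
    ring

variable {K : Type*} [Field K] {n : ℕ}

/-- The diagonal factor in a decomposition `g = u d w` can be sorted and the outer factors made
of determinant one. -/
theorem exists_sorted_decomposition {v : AbsoluteValue K ℝ}
    (U : Submonoid (Matrix (Fin n) (Fin n) K)) (hperm : ∀ σ : Equiv.Perm (Fin n),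
    σ.permMatrix K ∈ U) (hdet : ∀ M ∈ U, v M.det = 1) (i₀ : Fin n)
    (hdiag : ∀ c, v c = 1 → diagonal (Function.update 1 i₀ c) ∈ U)
    {u w : Matrix (Fin n) (Fin n) K} (hu : u ∈ U) (hw : w ∈ U) (d : Fin n → K) :
    ∃ (k₁ k₂ : SL(n, K)) (σ : Equiv.Perm (Fin n)) (c : K),
      (k₁ : Matrix (Fin n) (Fin n) K) ∈ U ∧ (k₂ : Matrix (Fin n) (Fin n) K) ∈ U ∧ v c = 1 ∧
      (Antitone fun i => v (d (σ i))) ∧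
      u * diagonal d * w = (k₁ : Matrix (Fin n) (Fin n) K) * diagonal (Function.update (1 : Fin n → K) i₀ c * (d ∘ σ)) * (k₂ : Matrix (Fin n) (Fin n) K) := by
  let σ := Tuple.sort fun i => -v (d i)
  have hσ : Antitone fun i => v (d (σ i)) := fun i j hij =>
    neg_le_neg_iff.1 (Tuple.monotone_sort (fun i => -v (d i)) hij)
  have hu₁ : u * (σ⁻¹).permMatrix K ∈ U := mul_mem hu (hperm _)
  have hw₁ : σ.permMatrix K * w ∈ U := mul_mem (hperm _) hw
  set u₁ := u * (σ⁻¹).permMatrix K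
  set w₁ := σ.permMatrix K * w
  have hα := hdet _ hu₁
  have hβ := hdet _ hw₁
  have hα0 : u₁.det ≠ 0 := v.ne_zero_iff.1 (by rw [hα]; exact one_ne_zero)
  have hβ0 : w₁.det ≠ 0 := v.ne_zero_iff.1 (by rw [hβ]; exact one_ne_zero)
  have hdd : ∀ c : K, (diagonal (Function.update (1 : Fin n → K) i₀ c)).det = c := by
    intro c
    rw [det_diagonal, Finset.prod_update_of_mem (Finset.mem_univ _)]
    simp
  -- Dividing each outer factor by its determinant in one coordinate puts it in `SL_n`. The product
  -- of both determinants goes into entry `i₀` of the diagonal, which keeps its absolute value.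
  refine ⟨⟨u₁ * diagonal (Function.update 1 i₀ u₁.det⁻¹), ?_⟩,
    ⟨diagonal (Function.update 1 i₀ w₁.det⁻¹) * w₁, ?_⟩, σ, u₁.det * w₁.det,
    mul_mem hu₁ (hdiag _ (by rw [map_inv₀, hα, inv_one])),
    mul_mem (hdiag _ (by rw [map_inv₀, hβ, inv_one])) hw₁,
    by rw [map_mul, hα, hβ, one_mul], hσ, ?_⟩
  · rw [det_mul, hdd, mul_inv_cancel₀ hα0]
  · rw [det_mul, hdd, inv_mul_cancel₀ hβ0]
  · have e1 : diagonal d = (σ⁻¹).permMatrix K * diagonal (d ∘ σ) * σ.permMatrix K := by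
      have := permMatrix_conj_diagonal (K := K) σ⁻¹ (d ∘ σ)
      rw [inv_inv] at this
      rw [this]
      congr 1
      ext i
      simp
    have e2 : diagonal (Function.update 1 i₀ u₁.det⁻¹) *
        diagonal (Function.update (1 : Fin n → K) i₀ (u₁.det * w₁.det) * (d ∘ σ)) *
        diagonal (Function.update 1 i₀ w₁.det⁻¹) = diagonal (d ∘ σ) := by
      rw [diagonal_mul_diagonal, diagonal_mul_diagonal]
      congr 1
      ext i
      by_cases hi : i = i₀
      · subst hi
        simp only [Function.update_self, Pi.mul_apply]
        field_simp
      · simp [hi]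
    calc u * diagonal d * w = u₁ * diagonal (d ∘ σ) * w₁ := by
          rw [e1]
          simp only [u₁, w₁, mul_assoc]
      _ = _ := by
          rw [← e2]
          simp only [mul_assoc]

end Matrix

/-! ### Cartan decomposition over `ℝ` and `ℂ`. -/

section Archimedean

open Matrix

variable {𝕜 : Type u} [RCLike 𝕜] {n : ℕ}

/-- **Singular value decomposition** of an invertible matrix. -/
theorem Matrix.exists_singular_value_decomposition (M : Matrix (Fin n) (Fin n) 𝕜)
    (hM : M.det ≠ 0) :
    ∃ u ∈ unitaryGroup (Fin n) 𝕜, ∃ w ∈ unitaryGroup (Fin n) 𝕜, ∃ d : Fin n → ℝ,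
      (∀ i, 0 < d i) ∧ M = u * diagonal (fun i => (d i : 𝕜)) * w := by
  have hinj : Function.Injective M.mulVec :=
    mulVec_injective_iff.2 (linearIndependent_cols_of_det_ne_zero hM)
  open scoped ComplexOrder in
  have hpos : (Mᴴ * M).PosDef := PosDef.conjTranspose_mul_self M hinj
  let V : Matrix (Fin n) (Fin n) 𝕜 := hpos.isHermitian.eigenvectorUnitary
  have hV : V ∈ unitaryGroup (Fin n) 𝕜 := (hpos.isHermitian.eigenvectorUnitary).2
  let ev := hpos.isHermitian.eigenvalues
  have hev : ∀ i, 0 < ev i := hpos.eigenvalues_pos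
  have hspec : Mᴴ * M = V * diagonal (fun i => (ev i : 𝕜)) * star V := by
    have := hpos.isHermitian.spectral_theorem
    rw [Unitary.conjStarAlgAut_apply] at this
    exact this
  have hVV : star V * V = 1 := (mem_unitaryGroup_iff').1 hV
  have hVV' : V * star V = 1 := (mem_unitaryGroup_iff).1 hV
  let d : Fin n → ℝ := fun i => Real.sqrt (ev i)
  have hd : ∀ i, 0 < d i := fun i => Real.sqrt_pos.2 (hev i)
  have hdd : ∀ i, (d i : 𝕜) ≠ 0 := fun i => RCLike.ofReal_ne_zero.2 (hd i).ne'
  have hsq : ∀ i, (ev i : 𝕜) = d i * d i := fun i => by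
    rw [← RCLike.ofReal_mul, Real.mul_self_sqrt (hev i).le]
  let D : Matrix (Fin n) (Fin n) 𝕜 := diagonal fun i => (d i : 𝕜)⁻¹
  have hDstar : star D = D := by
    rw [star_eq_conjTranspose, diagonal_conjTranspose]
    congr 1
    ext i
    simp
  -- With `Mᴴ M = V d² V*`, the matrix `u = M V d⁻¹` is unitary and `M = u d V*`.
  refine ⟨M * V * D, ?_, star V, Unitary.star_mem hV, d, hd, ?_⟩
  · rw [mem_unitaryGroup_iff']
    calc star (M * V * D) * (M * V * D) = D * (star V * (Mᴴ * M) * V) * D := by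
          rw [star_mul, star_mul, hDstar, star_eq_conjTranspose M]
          simp only [mul_assoc]
      _ = D * (star V * V * diagonal (fun i => (ev i : 𝕜)) * (star V * V)) * D := by
          rw [hspec]
          simp only [mul_assoc]
      _ = 1 := by
          rw [hVV, one_mul, mul_one, diagonal_mul_diagonal, diagonal_mul_diagonal, ← diagonal_one]
          congr 1
          ext i
          rw [hsq]
          have := hdd i
          field_simp
  · calc M = M * V * (D * diagonal (fun i => (d i : 𝕜))) * star V := by
          rw [diagonal_mul_diagonal]
          simp only [inv_mul_cancel₀ (hdd _), diagonal_one, mul_one]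
          rw [mul_assoc, hVV', mul_one]
      _ = _ := by simp only [mul_assoc]

theorem Matrix.exists_special_unitary_decomposition (hn : 0 < n) (g : SL(n, 𝕜)) :
    ∃ (k₁ k₂ : SL(n, 𝕜)) (a : Fin n → ℝ), (k₁ : Matrix (Fin n) (Fin n) 𝕜) ∈ unitaryGroup (Fin n) 𝕜 ∧
      (k₂ : Matrix (Fin n) (Fin n) 𝕜) ∈ unitaryGroup (Fin n) 𝕜 ∧ (∀ i, 0 < a i) ∧ Antitone a ∧
      (g : Matrix (Fin n) (Fin n) 𝕜) = k₁ * diagonal (fun i => (a i : 𝕜)) * k₂ := by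
  obtain ⟨u, hu, w, hw, d, hd, hg⟩ := exists_singular_value_decomposition
    (g : Matrix (Fin n) (Fin n) 𝕜) (by rw [g.2]; exact one_ne_zero)
  have hperm : ∀ σ : Equiv.Perm (Fin n), σ.permMatrix 𝕜 ∈ unitaryGroup (Fin n) 𝕜 := fun σ => by
    rw [mem_unitaryGroup_iff, star_eq_conjTranspose, conjTranspose_permMatrix,
      ← permMatrix_mul, inv_mul_cancel, permMatrix_one]
  have hdet : ∀ M ∈ unitaryGroup (Fin n) 𝕜, ‖M.det‖ = 1 := fun M hM =>
    CStarRing.norm_of_mem_unitary (det_of_mem_unitary hM)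
  have hdiag : ∀ c : 𝕜, ‖c‖ = 1 →
      diagonal (Function.update (1 : Fin n → 𝕜) ⟨0, hn⟩ c) ∈ unitaryGroup (Fin n) 𝕜 := by
    intro c hc
    rw [mem_unitaryGroup_iff, star_eq_conjTranspose, diagonal_conjTranspose,
      diagonal_mul_diagonal, ← diagonal_one]
    congr 1
    ext i
    by_cases hi : i = ⟨0, hn⟩
    · subst hi
      simp [RCLike.mul_conj, hc]
    · simp [hi]
  obtain ⟨k₁, k₂, σ, c, hk₁, hk₂, hc, hanti, h⟩ := exists_sorted_decomposition
    (v := IsAbsoluteValue.toAbsoluteValue (norm : 𝕜 → ℝ)) (unitaryGroup (Fin n) 𝕜)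
    hperm hdet ⟨0, hn⟩ hdiag hu hw (fun i => (d i : 𝕜))
  have hprod := prod_eq_one_of_polar (hg.trans h)
  -- The determinant says that `c` times a positive real is `1`; as `|c| = 1`, this forces `c = 1`,
  -- so the diagonal stays real and positive.
  have hc1 : c = 1 := by
    have e : (c : 𝕜) * ((∏ i, d (σ i) : ℝ) : 𝕜) = 1 := by
      rw [← hprod]
      simp only [Pi.mul_apply]
      rw [Finset.prod_mul_distrib, Finset.prod_update_of_mem (Finset.mem_univ _)]
      simp
    have hpos : 0 < ∏ i, d (σ i) := Finset.prod_pos fun i _ => hd _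
    have hc' : ‖c‖ = 1 := hc
    have e' := congrArg norm e
    rw [norm_mul, hc', one_mul, RCLike.norm_ofReal, abs_of_pos hpos, norm_one] at e'
    rwa [e', RCLike.ofReal_one, mul_one] at e
  subst hc1
  have ha : Function.update (1 : Fin n → 𝕜) ⟨0, hn⟩ 1 * ((fun i => (d i : 𝕜)) ∘ σ) =
      fun i => (d (σ i) : 𝕜) := by
    rw [show Function.update (1 : Fin n → 𝕜) ⟨0, hn⟩ 1 = 1 from Function.update_eq_self _ _,
      one_mul]
    rfl
  rw [ha] at h hprod
  refine ⟨k₁, k₂, fun i => d (σ i), hk₁, hk₂, fun i => hd _, fun i j hij => ?_, hg.trans h⟩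
  have h1 : ‖(d (σ j) : 𝕜)‖ ≤ ‖(d (σ i) : 𝕜)‖ := hanti hij
  rwa [RCLike.norm_ofReal, RCLike.norm_ofReal, abs_of_pos (hd _), abs_of_pos (hd _)] at h1

theorem LocalField.exists_isCartanValue_arch (hn : 0 < n)
    (g : SL(n, (LocalField.arch 𝕜 : LocalField.{u}))) :
    ∃ x, (LocalField.arch 𝕜).IsCartanValue g x := by
  obtain ⟨k₁, k₂, a, hk₁, hk₂, hpos, hanti, hg⟩ :=
    exists_special_unitary_decomposition (𝕜 := 𝕜) hn g
  let a' : SL(n, 𝕜) := ⟨diagonal fun i => (a i : 𝕜), by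
    rw [det_diagonal]
    exact prod_eq_one_of_polar hg⟩
  exact ⟨_, k₁, hk₁, a', ⟨a, hpos, hanti, rfl⟩, k₂, hk₂, Subtype.ext hg, rfl⟩

theorem LocalField.isPolarValue_arch {g : SL(n, (LocalField.arch 𝕜 : LocalField.{u}))}
    {x : Fin n → ℝ} (h : (LocalField.arch 𝕜).IsCartanValue g x) :
    IsPolarValue (K := 𝕜) (IsAbsoluteValue.toAbsoluteValue (norm : 𝕜 → ℝ)) g x := by
  obtain ⟨k₁, hk₁, a, ⟨d, hd, hanti, ha⟩, k₂, hk₂, hg, rfl⟩ := h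
  have hentry : ∀ k : SL(n, 𝕜), (k : Matrix (Fin n) (Fin n) 𝕜) ∈ unitaryGroup (Fin n) 𝕜 →
      (∀ i j, ‖k i j‖ ≤ 1) ∧ ∀ i j, ‖k⁻¹ i j‖ ≤ 1 := by
    intro k hk
    refine ⟨entry_norm_bound_of_unitary hk, fun i j => ?_⟩
    have e : ((k⁻¹ : SL(n, 𝕜)) : Matrix (Fin n) (Fin n) 𝕜) =
        star (k : Matrix (Fin n) (Fin n) 𝕜) := by
      calc _ = ((k⁻¹ : SL(n, 𝕜)) : Matrix (Fin n) (Fin n) 𝕜) * (k * star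
            (k : Matrix (Fin n) (Fin n) 𝕜)) := by rw [mem_unitaryGroup_iff.1 hk, mul_one]
        _ = _ := by rw [← mul_assoc, SpecialLinearGroup.val_inv_mul, one_mul]
    rw [e]
    exact entry_norm_bound_of_unitary (Unitary.star_mem hk) i j
  refine ⟨k₁, k₂, fun i => (d i : 𝕜), (hentry k₁ hk₁).1, (hentry k₁ hk₁).2, (hentry k₂ hk₂).1,
    (hentry k₂ hk₂).2, fun i j hij => ?_, ?_, ?_⟩
  · change ‖(d j : 𝕜)‖ ≤ ‖(d i : 𝕜)‖
    rw [RCLike.norm_ofReal, RCLike.norm_ofReal, abs_of_pos (hd _), abs_of_pos (hd _)]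
    exact hanti hij
  · rw [← ha]
    exact congrArg (fun g : SL(n, 𝕜) => (g : Matrix (Fin n) (Fin n) 𝕜)) hg
  · ext i
    have : (a : Matrix (Fin n) (Fin n) 𝕜) i i = (d i : 𝕜) :=
      (congrFun (congrFun ha i) i).trans (diagonal_apply_eq _ _)
    change Real.log ‖(a : Matrix (Fin n) (Fin n) 𝕜) i i‖ = Real.log ‖(d i : 𝕜)‖
    rw [this]

end Archimedean

/-! ### The absolute value of a nonarchimedean local field. -/

section Nonarchimedean

open Matrix ValuativeRel IsNonarchimedeanLocalField

variable (k : Type u) [Field k] [ValuativeRel k] [TopologicalSpace k]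
  [IsNonarchimedeanLocalField k]

theorem logAbs_nonarch_mul {x y : k} (hx : x ≠ 0) (hy : y ≠ 0) :
    (LocalField.nonarch k).logAbs (x * y) =
      (LocalField.nonarch k).logAbs x + (LocalField.nonarch k).logAbs y := by
  simp only [LocalField.logAbs, map_mul]
  rw [WithZero.log_mul (by simpa using hx) (by simpa using hy)]
  push_cast
  rfl

theorem logAbs_nonarch_le_iff {x y : k} (hx : x ≠ 0) (hy : y ≠ 0) :
    (LocalField.nonarch k).logAbs x ≤ (LocalField.nonarch k).logAbs y ↔
      valuation k x ≤ valuation k y := by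
  simp only [LocalField.logAbs]
  rw [Int.cast_le, WithZero.log_le_log (by simpa using hx) (by simpa using hy)]
  exact map_le_map_iff (valueGroupWithZeroIsoInt k)

open Classical in
/-- The absolute value of a nonarchimedean local field, as a function. -/
noncomputable def nonarchAbsFun (x : k) : ℝ :=
  -- Zero is treated apart because `WithZero.log 0 = 0` would give it absolute value `1`.
  if x = 0 then 0 else Real.exp ((LocalField.nonarch k).logAbs x)

theorem nonarchAbsFun_zero : nonarchAbsFun k 0 = 0 := if_pos rfl

theorem nonarchAbsFun_of_ne_zero {x : k} (hx : x ≠ 0) :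
    nonarchAbsFun k x = Real.exp ((LocalField.nonarch k).logAbs x) := if_neg hx

theorem nonarchAbsFun_nonneg (x : k) : 0 ≤ nonarchAbsFun k x := by
  rcases eq_or_ne x 0 with rfl | hx
  · rw [nonarchAbsFun_zero]
  · rw [nonarchAbsFun_of_ne_zero k hx]
    positivity

theorem nonarchAbsFun_le_iff {x y : k} :
    nonarchAbsFun k x ≤ nonarchAbsFun k y ↔ valuation k x ≤ valuation k y := by
  rcases eq_or_ne x 0 with rfl | hx
  · simp [nonarchAbsFun_zero, nonarchAbsFun_nonneg]
  · rcases eq_or_ne y 0 with rfl | hy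
    · rw [nonarchAbsFun_zero, nonarchAbsFun_of_ne_zero k hx]
      simp [hx, Real.exp_pos]
    · rw [nonarchAbsFun_of_ne_zero k hx, nonarchAbsFun_of_ne_zero k hy, Real.exp_le_exp,
        logAbs_nonarch_le_iff k hx hy]

/-- The absolute value `exp (-ω(x))` of a nonarchimedean local field. -/
noncomputable def nonarchAbs : AbsoluteValue k ℝ where
  toFun := nonarchAbsFun k
  map_mul' x y := by
    rcases eq_or_ne x 0 with rfl | hx
    · simp [nonarchAbsFun_zero]
    · rcases eq_or_ne y 0 with rfl | hy
      · simp [nonarchAbsFun_zero]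
      · rw [nonarchAbsFun_of_ne_zero k hx, nonarchAbsFun_of_ne_zero k hy,
          nonarchAbsFun_of_ne_zero k (mul_ne_zero hx hy), logAbs_nonarch_mul k hx hy, Real.exp_add]
  nonneg' := nonarchAbsFun_nonneg k
  eq_zero' x := by
    constructor
    · intro h
      by_contra hx
      rw [nonarchAbsFun_of_ne_zero k hx] at h
      exact (Real.exp_pos _).ne' h
    · rintro rfl
      exact nonarchAbsFun_zero k
  add_le' x y := by
    rcases le_total (valuation k x) (valuation k y) with h | h
    · refine le_add_of_nonneg_of_le (nonarchAbsFun_nonneg k x) ?_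
      rw [nonarchAbsFun_le_iff]
      exact (valuation k).map_add_le h le_rfl
    · refine le_add_of_le_of_nonneg ?_ (nonarchAbsFun_nonneg k y)
      rw [nonarchAbsFun_le_iff]
      exact (valuation k).map_add_le le_rfl h

theorem nonarchAbs_le_iff {x y : k} :
    nonarchAbs k x ≤ nonarchAbs k y ↔ valuation k x ≤ valuation k y := nonarchAbsFun_le_iff k

theorem nonarchAbs_le_one_iff {x : k} : nonarchAbs k x ≤ 1 ↔ x ∈ 𝒪[k] := by
  rw [← map_one (nonarchAbs k), nonarchAbs_le_iff, map_one, Valuation.mem_integer_iff]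

theorem log_nonarchAbs {x : k} (hx : x ≠ 0) :
    Real.log (nonarchAbs k x) = (LocalField.nonarch k).logAbs x := by
  change Real.log (nonarchAbsFun k x) = _
  rw [nonarchAbsFun_of_ne_zero k hx, Real.log_exp]

theorem exists_isCompact_nonarchAbs_le (R : ℝ) :
    ∃ B : Set k, IsCompact B ∧ {y | nonarchAbs k y ≤ R} ⊆ B := by
  -- Nontriviality of the valuation makes the powers of some `x⁻¹` unbounded, so the set lies in a
  -- closed valuation ball with an attained radius, which is compact.
  obtain ⟨z, hz⟩ : ∃ z : k, R ≤ nonarchAbs k z := by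
    obtain ⟨x, hx0, hx⟩ := Valuation.IsNontrivial.exists_lt_one (v := valuation k)
    have hx0' : x ≠ 0 := by simpa using hx0
    have h1 : 1 < nonarchAbs k x⁻¹ := by
      by_contra! h
      rw [← map_one (nonarchAbs k), nonarchAbs_le_iff, map_inv₀ (valuation k), map_one] at h
      exact absurd hx (not_lt.2 ((inv_le_one₀ (zero_lt_iff.2 (by simpa using hx0'))).1 h))
    obtain ⟨m, hm⟩ := pow_unbounded_of_one_lt R h1
    exact ⟨x⁻¹ ^ m, by rw [map_pow]; exact hm.le⟩
  refine ⟨_, isCompact_closedBall k (valuation k z), fun y hy => ?_⟩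
  exact (nonarchAbs_le_iff k).1 (le_trans hy hz)

variable {k} {n : ℕ}

theorem LocalField.isPolarValue_nonarch {g : SL(n, (LocalField.nonarch k : LocalField.{u}))}
    {x : Fin n → ℝ} (h : (LocalField.nonarch k).IsCartanValue g x) :
    IsPolarValue (K := k) (nonarchAbs k) g x := by
  obtain ⟨_, ⟨k₁, rfl⟩, a, ⟨d, hanti, ha⟩, _, ⟨k₂, rfl⟩, hg, rfl⟩ := h
  have hentry : ∀ l : SL(n, 𝒪[k]), ∀ i j, nonarchAbs k
      ((SpecialLinearGroup.map (algebraMap 𝒪[k] k) l : SL(n, k)) i j) ≤ 1 := fun l i j =>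
    (nonarchAbs_le_one_iff k).2 (l i j).2
  have hg' : ((g : SL(n, k)) : Matrix (Fin n) (Fin n) k) =
      (SpecialLinearGroup.map (algebraMap 𝒪[k] k) k₁ : SL(n, k)) * diagonal d *
        (SpecialLinearGroup.map (algebraMap 𝒪[k] k) k₂ : SL(n, k)) := by
    rw [← ha]
    exact congrArg (fun g : SL(n, k) => (g : Matrix (Fin n) (Fin n) k)) hg
  refine ⟨_, _, d, hentry k₁, ?_, hentry k₂, ?_,
    fun i j hij => (nonarchAbs_le_iff k).2 (hanti hij), hg', ?_⟩
  · rw [← map_inv]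
    exact hentry _
  · rw [← map_inv]
    exact hentry _
  · ext i
    rw [log_nonarchAbs k (ne_zero_of_polar hg' i)]
    exact congrArg _ ((congrFun (congrFun ha i) i).trans (diagonal_apply_eq _ _))

end Nonarchimedean

/-! ### Cartan decomposition over a nonarchimedean local field. -/

section NonarchimedeanDecomposition

open Matrix ValuativeRel IsNonarchimedeanLocalField

theorem mem_range_map_of_entry_mem {k : Type u} [Field k] [ValuativeRel k] {n : ℕ} {g : SL(n, k)} (hg : ∀ i j, g i j ∈ 𝒪[k]) :
    g ∈ Set.range (SpecialLinearGroup.map (n := Fin n) (algebraMap 𝒪[k] k)) := by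
  let M : Matrix (Fin n) (Fin n) 𝒪[k] := fun i j => ⟨g i j, hg i j⟩
  have hM : M.map (algebraMap 𝒪[k] k) = (g : Matrix (Fin n) (Fin n) k) := rfl
  have hdet : M.det = 1 := by
    apply Subtype.val_injective
    have h := (algebraMap 𝒪[k] k).map_det M
    rw [show (algebraMap 𝒪[k] k).mapMatrix M = (g : Matrix (Fin n) (Fin n) k) from hM, g.2] at h
    exact h
  exact ⟨⟨M, hdet⟩, Subtype.ext hM⟩

/-- Dividing by an entry of largest valuation makes all entries integral, so that Smith normal form
over `𝒪[k]` applies. -/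
theorem exists_clear_denominators {k : Type u} [Field k] [ValuativeRel k] {n : ℕ}
    {g : Matrix (Fin n) (Fin n) k} (hn : 0 < n) (hg : g.det ≠ 0) :
    ∃ (z : k) (G : Matrix (Fin n) (Fin n) 𝒪[k]), z ≠ 0 ∧
      g = z • G.map (algebraMap 𝒪[k] k) := by
  have : Nonempty (Fin n × Fin n) := ⟨(⟨0, hn⟩, ⟨0, hn⟩)⟩
  obtain ⟨⟨p, q⟩, hpq⟩ := Finite.exists_max fun x : Fin n × Fin n => valuation k (g x.1 x.2)
  have hz : g p q ≠ 0 := by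
    intro h0
    apply hg
    rw [show g = 0 by
      ext i j
      have := hpq (i, j)
      simpa [h0] using this]
    have : Nonempty (Fin n) := ⟨⟨0, hn⟩⟩
    exact det_zero
  refine ⟨g p q, fun i j => ⟨g i j / g p q, ?_⟩, hz, ?_⟩
  · rw [Valuation.mem_integer_iff, map_div₀]
    exact div_le_one_of_le₀ (hpq (i, j)) zero_le
  · ext i j
    exact (mul_div_cancel₀ (g i j) hz).symm

variable {k : Type u} [Field k] [ValuativeRel k] [TopologicalSpace k]
  [IsNonarchimedeanLocalField k] {n : ℕ}

/-- The submonoid `GL_n(𝒪)` of the matrices over `k`. -/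
def integralUnits (k : Type u) [Field k] [ValuativeRel k] [TopologicalSpace k]
    [IsNonarchimedeanLocalField k] (n : ℕ) : Submonoid (Matrix (Fin n) (Fin n) k) where
  carrier := {M | (∀ i j, M i j ∈ 𝒪[k]) ∧ nonarchAbs k M.det = 1}
  one_mem' := by
    refine ⟨fun i j => ?_, by simp⟩
    rw [one_apply]
    split_ifs
    · exact one_mem _
    · exact zero_mem _
  mul_mem' := by
    rintro M N ⟨hM, hM'⟩ ⟨hN, hN'⟩
    refine ⟨fun i j => ?_, by rw [det_mul, map_mul, hM', hN', one_mul]⟩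
    rw [mul_apply]
    exact sum_mem fun l _ => mul_mem (hM i l) (hN l j)

/-- The determinant and its inverse both have absolute value at most one, and their product is one.
-/
theorem map_mem_integralUnits {M : Matrix (Fin n) (Fin n) 𝒪[k]} (hM : IsUnit M.det) :
    M.map (algebraMap 𝒪[k] k) ∈ integralUnits k n := by
  refine ⟨fun i j => (M i j).2, ?_⟩
  rw [show (M.map (algebraMap 𝒪[k] k)).det = algebraMap 𝒪[k] k M.det from
    ((algebraMap 𝒪[k] k).map_det M).symm]
  obtain ⟨N, hN⟩ := hM.exists_right_inv
  have h := congrArg (fun x => nonarchAbs k (algebraMap 𝒪[k] k x)) hN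
  simp only [map_mul, map_one] at h
  have h1 : nonarchAbs k (algebraMap 𝒪[k] k M.det) ≤ 1 := (nonarchAbs_le_one_iff k).2 M.det.2
  have h2 : nonarchAbs k (algebraMap 𝒪[k] k N) ≤ 1 := (nonarchAbs_le_one_iff k).2 N.2
  refine le_antisymm h1 ?_
  rw [← h]
  exact mul_le_of_le_one_right ((nonarchAbs k).nonneg _) h2

theorem Matrix.exists_integral_decomposition (hn : 0 < n) (g : SL(n, k)) :
    ∃ (k₁ k₂ : SL(n, k)) (a : Fin n → k),
      (∀ i j, k₁ i j ∈ 𝒪[k]) ∧ (∀ i j, k₂ i j ∈ 𝒪[k]) ∧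
      (Antitone fun i => valuation k (a i)) ∧
      (g : Matrix (Fin n) (Fin n) k) = k₁ * diagonal a * k₂ := by
  have hg0 : (g : Matrix (Fin n) (Fin n) k).det ≠ 0 := by
    rw [g.2]
    exact one_ne_zero
  obtain ⟨z, G, hz, hG⟩ := exists_clear_denominators hn hg0
  have hGdet : G.det ≠ 0 := by
    intro h
    apply hg0
    rw [hG, det_smul, show (G.map (algebraMap 𝒪[k] k)).det = algebraMap 𝒪[k] k G.det from
      ((algebraMap 𝒪[k] k).map_det G).symm, h, map_zero, mul_zero]
  obtain ⟨B, Q, d, hB, hQ, hBQ⟩ := exists_smith_normal_form G hGdet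
  let φ : 𝒪[k] →+* k := algebraMap 𝒪[k] k
  have hdec : (g : Matrix (Fin n) (Fin n) k) =
      B.map φ * diagonal (fun i => z * φ (d i)) * Q.map φ := by
    rw [hG, hBQ, Matrix.map_mul, Matrix.map_mul, diagonal_map (map_zero _), ← smul_mul_assoc,
      ← mul_smul_comm, ← diagonal_smul]
    rfl
  have hperm : ∀ σ : Equiv.Perm (Fin n), σ.permMatrix k ∈ integralUnits k n := by
    intro σ
    have h := map_mem_integralUnits (k := k) (M := σ.permMatrix 𝒪[k]) (by
      rw [det_permutation]
      exact (Equiv.Perm.sign σ).isUnit.map (Int.castRingHom 𝒪[k]))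
    convert h
    ext i j
    simp only [map_apply, PEquiv.toMatrix_apply]
    split_ifs <;> simp
  have hdiag : ∀ c : k, nonarchAbs k c = 1 →
      diagonal (Function.update (1 : Fin n → k) ⟨0, hn⟩ c) ∈ integralUnits k n := by
    intro c hc
    refine ⟨fun i j => ?_, ?_⟩
    · rw [diagonal_apply]
      split_ifs
      · by_cases hi : i = ⟨0, hn⟩
        · subst hi
          rw [Function.update_self, ← nonarchAbs_le_one_iff, hc]
        · rw [Function.update_of_ne hi]
          exact one_mem _
      · exact zero_mem _
    · rw [det_diagonal, Finset.prod_update_of_mem (Finset.mem_univ _)]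
      simpa using hc
  obtain ⟨k₁, k₂, σ, c, hk₁, hk₂, hc, hanti, h⟩ := exists_sorted_decomposition
    (v := nonarchAbs k) (integralUnits k n) hperm (fun M hM => hM.2) ⟨0, hn⟩ hdiag
    (map_mem_integralUnits hB) (map_mem_integralUnits hQ) (fun i => z * φ (d i))
  have habs : ∀ i, nonarchAbs k (Function.update (1 : Fin n → k) ⟨0, hn⟩ c i) = 1 := by
    intro i
    by_cases hi : i = ⟨0, hn⟩
    · subst hi
      rw [Function.update_self, hc]
    · simp [Function.update_of_ne hi]
  refine ⟨k₁, k₂, _, hk₁.1, hk₂.1, fun i j hij => ?_, hdec.trans h⟩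
  rw [← nonarchAbs_le_iff]
  simp only [Pi.mul_apply, map_mul (nonarchAbs k), habs, one_mul]
  simpa using hanti hij

theorem LocalField.exists_isCartanValue_nonarch (hn : 0 < n)
    (g : SL(n, (LocalField.nonarch k : LocalField.{u}))) :
    ∃ x, (LocalField.nonarch k).IsCartanValue g x := by
  obtain ⟨k₁, k₂, a, hk₁, hk₂, hanti, hg⟩ := exists_integral_decomposition (k := k) hn g
  let a' : SL(n, k) := ⟨diagonal a, by
    rw [det_diagonal]
    exact prod_eq_one_of_polar hg⟩
  exact ⟨_, k₁, mem_range_map_of_entry_mem hk₁, a', ⟨a, hanti, rfl⟩, k₂,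
    mem_range_map_of_entry_mem hk₂, Subtype.ext hg, rfl⟩

end NonarchimedeanDecomposition

/-! ### The two kinds of local field together. -/

theorem LocalField.isCartanValue_cartanProj {n : ℕ} (k : LocalField.{u}) {g : SL(n, k)}
    (h : ∃ x, k.IsCartanValue g x) : k.IsCartanValue g (k.cartanProj g) := by
  rw [LocalField.cartanProj, dif_pos h]
  exact h.choose_spec

theorem proposition4p1 (k : LocalField.{u}) (n : ℕ) (hn : 2 ≤ n)
    (Γ : Subgroup SL(n, k)) (hdiscrete : DiscreteTopology Γ)
    (hproper : ProperlyDiscontinuousSMul Γ (SL(n, k) ⧸ SLcorner n k))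
    (htorsion : ¬ IsMulTorsion Γ) :
    ∃ i : ℕ, 1 ≤ i ∧ i ≤ n - 1 ∧
      {γ : Γ | k.cartanProj (γ : SL(n, k)) ∉ Ccomp n i ∪ Ccomp n (n - i)}.Finite ∧
      (¬ IsVirtuallyCyclic Γ → Ccomp n i = Ccomp n (n - i)) := by
  cases k with
  | arch 𝕜 =>
    exact exists_Ccomp_of_polarValue (K := 𝕜)
      (v := IsAbsoluteValue.toAbsoluteValue (norm : 𝕜 → ℝ))
      (fun R => ⟨Metric.closedBall 0 R, isCompact_closedBall 0 R, fun y hy => by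
        rw [mem_closedBall_zero_iff]
        exact hy⟩) hn Γ hproper htorsion _ fun g => LocalField.isPolarValue_arch
          (LocalField.isCartanValue_cartanProj _
            (LocalField.exists_isCartanValue_arch (by omega) g))
  | nonarch k =>
    have : T1Space k := by
      let _ := IsTopologicalAddGroup.rightUniformSpace k
      have := isUniformAddGroup_of_addCommGroup (G := k)
      infer_instance
    exact exists_Ccomp_of_polarValue (K := k) (v := nonarchAbs k)
      (exists_isCompact_nonarchAbs_le k) hn Γ hproper htorsion _ fun g =>
        LocalField.isPolarValue_nonarch (LocalField.isCartanValue_cartanProj _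
          (LocalField.exists_isCartanValue_nonarch (by omega) g))
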